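/- All rings are commutative with identity and all modules are finitely generated. For a ring homomorphism $T\to R$, an $R$-module $M$ is *liftable* to $T$ if there is a $T$-module $M'$ with $M\cong M'\otimes_T R$ and $\operatorname{Tor}_i^T(M',R)=0$ for all $i>0$; it is *weakly liftable* to $T$ if it is a direct summand of a liftable $R$-module. For a $T$-module $M$ let $$\mathcal L_{nwl}(M)=\{0\}\cup\{f\in\operatorname{Ann}_T(M) : M \text{ is not weakly liftable to } T \text{ as a } T/(f)\text{-module}\}.$$ A Noetherian local ring $(A,\mathfrak n)$ is *approximately Gorenstein* if for every integer $N\ge 0$ there is an ideal $K\subseteq\mathfrak n^N$ such that $A/K$ is a Gorenstein local ring. **Proposition.** Let $(T,m)$ be a Noetherian local ring and let $I\subsetneq T$ be an ideal such that $T/I$ is approximately Gorenstein. By a *chain* for $I$ we mean a sequence of $m$-primary irreducible ideals $J_0\supseteq J_1\supseteq\cdots$ of $T$ containing $I$ such that for every $N$ some $J_i$ is contained in $I+m^N$, together with elements $s_i\in T$ representing generators of the socles of the rings $T/J_i$, i.e. $(J_i:m)=J_i+(s_i)$. 1. Chains for $I$ exist. 2. For every chain for $I$, the ideals $I_i=(IJ_i:s_i)\cap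 I$ form an increasing sequence, which stabilizes; hence $\mathfrak a=\bigcup_i I_i$ is an ideal of $T$, equal to $I_i$ for all large $i$. For every nonzerodivisor $f$ of $T$ one has $f\in\mathcal L_{nwl}(T/I)$ if and only if $f\in\mathfrak a$. 3. If every nonzero element of $I$ is a nonzerodivisor of $T$ (for instance, if $T$ is a domain), then $\mathcal L_{nwl}(T/I)$ is an ideal of $T$, and $\mathcal L_{nwl}(T/I)=\mathfrak a$ for every chain for $I$. -/

import Mathlib

universe u

open CategoryTheory

/-- An `R`-module `M` is liftable along the ring homomorphism `T → R` if there is a finitely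
generated `T`-module `M'` with `M ≅ R ⊗ M'` (as `R`-modules) and `Tor_i^T(M', R) = 0` for all
`i > 0`. -/
def IsLiftable (T R : Type u) [CommRing T] [CommRing R] [Algebra T R]
    (M : Type u) [AddCommGroup M] [Module R M] : Prop :=
  ∃ M' : ModuleCat.{u} T, Module.Finite T M' ∧
    (∀ i : ℕ, 0 < i →
      Limits.IsZero (((Tor (ModuleCat.{u} T) i).obj M').obj (ModuleCat.of T R))) ∧
    Nonempty (M ≃ₗ[R] TensorProduct T R M')

/-- An `R`-module `M` is weakly liftable along `T → R` if it is a direct summand of a liftable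
(finitely generated) `R`-module. -/
def IsWeaklyLiftable (T R : Type u) [CommRing T] [CommRing R] [Algebra T R]
    (M : Type u) [AddCommGroup M] [Module R M] : Prop :=
  ∃ (N : Type u) (_ : AddCommGroup N) (_ : Module R N),
    Module.Finite R N ∧ IsLiftable T R (M × N)

/-- `M` is weakly liftable to `T` as a module over `T/(f)`, where `f` annihilates the `T`-module
`M`; the `T/(f)`-module structure on `M` is the one induced by its `T`-module structure. -/
def IsWeaklyLiftableMod {T : Type u} [CommRing T] (M : Type u) [AddCommGroup M] [Module T M]
    (f : T) (hf : Module.IsTorsionBy T M f) : Prop :=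
  letI : Module (T ⧸ Ideal.span {f}) M := hf.module
  IsWeaklyLiftable T (T ⧸ Ideal.span {f}) M

/-- The non-weakly-liftable locus of `M`: all `f` in the annihilator of `M` such that `M` is not
weakly liftable to `T` as a `T/(f)`-module; by convention `0` belongs to the locus. -/
def nwlLocus (T : Type u) [CommRing T] (M : Type u) [AddCommGroup M] [Module T M] : Set T :=
  {f | ∃ hf : Module.IsTorsionBy T M f, f = 0 ∨ ¬ IsWeaklyLiftableMod M f hf}

/-- A Gorenstein local ring: a Noetherian local ring that is Cohen-Macaulay of type one, i.e. some
regular sequence in it (necessarily a system of parameters) generates an irreducible ideal with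
Artinian quotient. -/
def IsGorensteinLocal (A : Type u) [CommRing A] : Prop :=
  IsLocalRing A ∧ IsNoetherianRing A ∧
    ∃ xs : List A, RingTheory.Sequence.IsRegular A xs ∧
      IsArtinianRing (A ⧸ Ideal.ofList xs) ∧ InfIrred (Ideal.ofList xs)

/-- A Noetherian local ring `(A, m)` is approximately Gorenstein if for every `N` there is an ideal
`K ⊆ m ^ N` such that `A / K` is Gorenstein. -/
def IsApproximatelyGorensteinLocal (A : Type u) [CommRing A] : Prop :=
  IsNoetherianRing A ∧ ∃ _ : IsLocalRing A, ∀ N : ℕ,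
    ∃ K : Ideal A, K ≤ IsLocalRing.maximalIdeal A ^ N ∧ IsGorensteinLocal (A ⧸ K)

/-- `J i` is a decreasing chain of irreducible ideals containing `I`, primary to the maximal ideal
`m` of `T`, whose images in `T/I` are cofinal with the powers of the maximal ideal, and `s i ∈ T`
represents a generator of the socle `(J i : m) / J i` of `T / J i`. -/
structure IsSocleChain {T : Type u} [CommRing T] [IsLocalRing T] (I : Ideal T)
    (J : ℕ → Ideal T) (s : ℕ → T) : Prop where
  le : ∀ i, I ≤ J i
  antitone : Antitone J
  irreducible : ∀ i, InfIrred (J i)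
  primary : ∀ i, ∃ l : ℕ, IsLocalRing.maximalIdeal T ^ l ≤ J i
  cofinal : ∀ N : ℕ, ∃ i, J i ≤ I ⊔ IsLocalRing.maximalIdeal T ^ N
  socle : ∀ i, (J i).colon (IsLocalRing.maximalIdeal T : Set T) = J i ⊔ Ideal.span {s i}

/-- The ideal `(I J : s) ∩ I`. -/
def socleColon {T : Type u} [CommRing T] (I J : Ideal T) (s : T) : Ideal T :=
  (I * J).colon {s} ⊓ I

/-! ### Irreducible primary ideals and their socles -/

section Irreducible

/-! For a nonzerodivisor `f ∈ I`, weak liftability of `T/I` from `T/(f)` is equivalent to the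
existence of a `T`-linear `φ : I → T/I` with `φ f = 1` (`isWeaklyLiftableMod_iff`). Given a lift `M`
on which `f` is regular, with `M/fM ≅ T/I ⊕ N`, let `w ∈ M` lift `(1, 0)`; then `I w ⊆ f M`, and `a
↦ a w / f` followed by the projection to `T/I` is such a `φ`. Conversely, `φ` splits `T/I → I/fI`,
`1 ↦ f`, and `I` itself is the lift.

By Krull's intersection theorem `φ` exists as soon as its analogue exists modulo every `J i`. Since
`T/J i` is Artinian with simple socle generated by `s i`, a map `I → T/J i` with `f ↦ 1` exists
exactly when `s i * f ∉ I * J i`. So `φ` fails to exist iff `f` lies in some `socleColon`. Reducing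
maps from `T/J j` to `T/J i` makes these ideals increase.

Chains come from Gorenstein quotients: powers of a regular system of parameters generate arbitrarily
small irreducible ideals. -/

lemma Ideal.mem_sup_span_singleton_iff {R : Type*} [CommRing R] {J : Ideal R} {x y : R} :
    x ∈ J ⊔ Ideal.span {y} ↔ ∃ a, x - a * y ∈ J := by
  rw [Submodule.mem_sup]
  constructor
  · rintro ⟨j, hj, z, hz, rfl⟩
    obtain ⟨a, rfl⟩ := Ideal.mem_span_singleton'.mp hz
    exact ⟨a, by simpa using hj⟩
  · rintro ⟨a, ha⟩
    exact ⟨_, ha, a * y, Ideal.mem_span_singleton'.mpr ⟨a, rfl⟩, by ring⟩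

/-- An ideal with a smallest ideal strictly above it is irreducible. -/
lemma Ideal.infIrred_of_forall_mem_sup {R : Type*} [CommRing R] {J : Ideal R} {s : R}
    (hs : s ∉ J) (h : ∀ x ∉ J, s ∈ J ⊔ Ideal.span {x}) : InfIrred J := by
  refine ⟨fun hm => hs ?_, fun b c hbc => ?_⟩
  · rw [isMax_iff_eq_top.mp hm]; trivial
  · have key : ∀ b : Ideal R, J ≤ b → b ≠ J → s ∈ b := fun b hb hne => by
      obtain ⟨x, hxb, hxJ⟩ := SetLike.exists_of_lt (lt_of_le_of_ne hb hne.symm)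
      exact (sup_le hb ((Ideal.span_singleton_le_iff_mem _).mpr hxb)) (h x hxJ)
    by_contra! hne
    exact hs (hbc ▸ ⟨key b (hbc ▸ inf_le_left) hne.1, key c (hbc ▸ inf_le_right) hne.2⟩)

lemma Ideal.ne_top_of_infIrred {R : Type*} [CommRing R] {J : Ideal R} (h : InfIrred J) : J ≠ ⊤ :=
  fun hJ => h.1 (hJ ▸ isMax_top)

/-- A nonzero element of a module killed by a power of `m` has a nonzero multiple killed by `m`. -/
lemma exists_smul_ne_zero_of_pow_smul_eq_zero {R N : Type*} [CommRing R] [AddCommGroup N]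
    [Module R N] {m : Ideal R} {x : N} {l : ℕ} (hl : ∀ y ∈ m ^ l, y • x = 0) (hx : x ≠ 0) :
    ∃ t : R, t • x ≠ 0 ∧ ∀ y ∈ m, y • t • x = 0 := by
  induction l with
  | zero => exact absurd (by simpa using hl 1 (by simp)) hx
  | succ l ih =>
    by_cases h : ∀ y ∈ m ^ l, y • x = 0
    · exact ih h
    · push Not at h
      obtain ⟨t, ht, htx⟩ := h
      refine ⟨t, htx, fun y hy => ?_⟩
      rw [smul_smul]
      exact hl _ (by rw [pow_succ']; exact Ideal.mul_mem_mul hy ht)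

lemma Ideal.exists_mul_notMem_of_pow_le {R : Type*} [CommRing R] {m J : Ideal R} {l : ℕ}
    (hl : m ^ l ≤ J) {x : R} (hx : x ∉ J) : ∃ t : R, t * x ∉ J ∧ ∀ y ∈ m, y * (t * x) ∈ J := by
  have key : ∀ z : R, z • (Ideal.Quotient.mk J x) = 0 ↔ z * x ∈ J := fun z => by
    rw [← Ideal.Quotient.eq_zero_iff_mem, map_mul]; rfl
  obtain ⟨t, h1, h2⟩ := exists_smul_ne_zero_of_pow_smul_eq_zero (m := m) (l := l)
    (x := Ideal.Quotient.mk J x)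
    (fun y hy => (key y).mpr (Ideal.mul_mem_right _ _ (hl hy)))
    (fun h => hx (Ideal.Quotient.eq_zero_iff_mem.mp h))
  refine ⟨t, fun h => h1 ((key t).mpr h), fun y hy => ?_⟩
  rw [← mul_assoc, ← key, ← smul_smul]
  exact h2 y hy

variable {R : Type*} [CommRing R] [IsLocalRing R]

open IsLocalRing

/-- Any `x ∉ J` has a multiple `t * x ∉ J` in the socle, so `t * x ≡ a * s` modulo `J`. Here `a`
must be a unit, since the maximal ideal kills `s`. Thus `s` generates the smallest nonzero ideal of
`R/J`. -/
lemma Ideal.socle_of_colon_eq {J : Ideal R} {s : R} {l : ℕ} (hl : maximalIdeal R ^ l ≤ J)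
    (hJ : J ≠ ⊤) (hs : J.colon (maximalIdeal R : Set R) = J ⊔ Ideal.span {s}) :
    s ∉ J ∧ ∀ x ∉ J, s ∈ J ⊔ Ideal.span {x} := by
  have key : ∀ x ∉ J, ∃ t : R, t * x ∉ J ∧ ∃ a, t * x - a * s ∈ J := fun x hx => by
    obtain ⟨t, h1, h2⟩ := Ideal.exists_mul_notMem_of_pow_le hl hx
    refine ⟨t, h1, Ideal.mem_sup_span_singleton_iff.mp (hs ▸ Submodule.mem_colon.mpr ?_)⟩
    intro y hy
    rw [smul_eq_mul, mul_comm]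
    exact h2 y hy
  have hsm : ∀ a ∈ maximalIdeal R, a * s ∈ J := fun a ha => by
    have : s ∈ J.colon (maximalIdeal R : Set R) :=
      hs ▸ Ideal.mem_sup_right (Ideal.mem_span_singleton_self s)
    simpa [mul_comm] using Submodule.mem_colon.mp this a ha
  refine ⟨fun hsJ => ?_, fun x hx => ?_⟩
  · obtain ⟨t, h1, a, ha⟩ := key 1 (fun h => hJ ((Ideal.eq_top_iff_one _).mpr h))
    exact h1 (by simpa using J.add_mem ha (J.mul_mem_left a hsJ))
  · obtain ⟨t, h1, a, ha⟩ := key x hx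
    have hu : IsUnit a := by
      by_contra hu
      exact h1 (by simpa using J.add_mem ha (hsm a ((mem_maximalIdeal a).mpr hu)))
    obtain ⟨b, hb⟩ := hu.exists_left_inv
    rw [Ideal.mem_sup_span_singleton_iff]
    refine ⟨b * t, ?_⟩
    have := J.mul_mem_left (-b) ha
    rwa [show -b * (t * x - a * s) = (b * a) * s - b * t * x by ring, hb, one_mul] at this

/-- If `s'` and `y` are socle elements outside `J`, irreducibility gives a common `z ∉ J` with `z ≡
a * s' ≡ b * y`. As `y` is killed by the maximal ideal, `b` is a unit, so `y` is a multiple of `s'`.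
-/
lemma Ideal.exists_socle_of_infIrred {J : Ideal R} {l : ℕ} (hl : maximalIdeal R ^ l ≤ J)
    (hJ : InfIrred J) : ∃ s, J.colon (maximalIdeal R : Set R) = J ⊔ Ideal.span {s} := by
  obtain ⟨s, h1, h2⟩ := Ideal.exists_mul_notMem_of_pow_le hl
    (fun h => Ideal.ne_top_of_infIrred hJ ((Ideal.eq_top_iff_one _).mpr h))
  set s' := s * 1
  refine ⟨s', le_antisymm (fun y hy => ?_) (sup_le Ideal.le_colon ?_)⟩
  · have hy' : ∀ a ∈ maximalIdeal R, a * y ∈ J := fun a ha => by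
      simpa [mul_comm] using Submodule.mem_colon.mp hy a ha
    by_cases hyJ : y ∈ J
    · exact Ideal.mem_sup_left hyJ
    have hne : (J ⊔ Ideal.span {s'}) ⊓ (J ⊔ Ideal.span {y}) ≠ J := fun h => by
      rcases hJ.2 h with h | h
      · exact h1 (h ▸ Ideal.mem_sup_right (Ideal.mem_span_singleton_self _))
      · exact hyJ (h ▸ Ideal.mem_sup_right (Ideal.mem_span_singleton_self _))
    obtain ⟨z, ⟨hz1, hz2⟩, hzJ⟩ := SetLike.exists_of_lt
      (lt_of_le_of_ne (le_inf le_sup_left le_sup_left) hne.symm)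
    obtain ⟨a, ha⟩ := Ideal.mem_sup_span_singleton_iff.mp hz1
    obtain ⟨b, hb⟩ := Ideal.mem_sup_span_singleton_iff.mp hz2
    have hu : IsUnit b := by
      by_contra hu
      exact hzJ (by simpa using J.add_mem hb (hy' b ((mem_maximalIdeal b).mpr hu)))
    obtain ⟨c, hc⟩ := hu.exists_left_inv
    rw [Ideal.mem_sup_span_singleton_iff]
    refine ⟨c * a, ?_⟩
    have := J.mul_mem_left c (J.sub_mem ha hb)
    rwa [show c * (z - a * s' - (z - b * y)) = (c * b) * y - c * a * s' by ring, hc,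
      one_mul] at this
  · rw [Ideal.span_singleton_le_iff_mem, Submodule.mem_colon]
    intro a ha
    rw [smul_eq_mul, mul_comm]
    exact h2 a ha

/-- Irreducibility of an `m`-primary ideal `Q + (x)` passes to `Q + (x ^ t)` when `x` is regular
modulo `Q`. -/
lemma Ideal.infIrred_sup_span_pow {Q : Ideal R} {x : R} (hx : ∀ y, x * y ∈ Q → y ∈ Q) {l : ℕ}
    (hl : maximalIdeal R ^ l ≤ Q ⊔ Ideal.span {x}) (hJ : InfIrred (Q ⊔ Ideal.span {x})) (t : ℕ) :
    InfIrred (Q ⊔ Ideal.span {x ^ (t + 1)}) := by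
  obtain ⟨s, hs⟩ := Ideal.exists_socle_of_infIrred hl hJ
  obtain ⟨hs1, hs2⟩ := Ideal.socle_of_colon_eq hl (Ideal.ne_top_of_infIrred hJ) hs
  have hxt : ∀ (t : ℕ) (y : R), x ^ t * y ∈ Q → y ∈ Q := fun t => by
    induction t with
    | zero => simp
    | succ t ih => exact fun y hy => ih _ (hx _ (by rwa [pow_succ', mul_assoc] at hy))
  have hl' : maximalIdeal R ^ (l * (1 + (t + 1))) ≤ Q ⊔ Ideal.span {x ^ (t + 1)} := by
    rw [pow_mul]
    refine (Ideal.pow_right_mono hl _).trans (Ideal.sup_pow_add_le_pow_sup_pow.trans ?_)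
    rw [pow_one, Ideal.span_singleton_pow]
  have hxm : x ∈ maximalIdeal R :=
    le_maximalIdeal (Ideal.ne_top_of_infIrred hJ)
      (Ideal.mem_sup_right (Ideal.mem_span_singleton_self x))
  -- Multiplication by `x ^ t` embeds `R/(Q + (x))` into `R/(Q + (x ^ (t + 1)))` and carries the
  -- socle generator to the new one.
  refine Ideal.infIrred_of_forall_mem_sup (s := x ^ t * s) (fun h => hs1 ?_) (fun y hy => ?_)
  · obtain ⟨a, ha⟩ := Ideal.mem_sup_span_singleton_iff.mp h
    rw [Ideal.mem_sup_span_singleton_iff]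
    exact ⟨a, hxt t _ (by convert ha using 1; ring)⟩
  -- A multiple `r * y` in the socle is killed by `x`, so cancelling `x` modulo `Q` puts it in the
  -- image of this embedding.
  · obtain ⟨r, hr1, hr2⟩ := Ideal.exists_mul_notMem_of_pow_le hl' hy
    obtain ⟨a, ha⟩ := Ideal.mem_sup_span_singleton_iff.mp (hr2 x hxm)
    have hra : r * y - a * x ^ t ∈ Q := hx _ (by convert ha using 1; ring)
    have haJ : a ∉ Q ⊔ Ideal.span {x} := fun h => hr1 <| by
      obtain ⟨b, hb⟩ := Ideal.mem_sup_span_singleton_iff.mp h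
      rw [Ideal.mem_sup_span_singleton_iff]
      exact ⟨b, by convert Q.add_mem hra (Q.mul_mem_right (x ^ t) hb) using 1; ring⟩
    obtain ⟨c, hc⟩ := Ideal.mem_sup_span_singleton_iff.mp (hs2 a haJ)
    obtain ⟨b, hb⟩ := Ideal.mem_sup_span_singleton_iff.mp
      (show s - c * a ∈ Q ⊔ Ideal.span {x} by exact hc)
    rw [Ideal.mem_sup_span_singleton_iff]
    refine ⟨c * r, Ideal.mem_sup_span_singleton_iff.mpr ⟨b, ?_⟩⟩
    convert Q.sub_mem (Q.mul_mem_right (x ^ t) hb) (Q.mul_mem_left c hra) using 1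
    ring

end Irreducible

/-! ### Existence of chains -/

section Chains

open IsLocalRing RingTheory.Sequence

lemma isSMulRegular_quotient_smul_top_iff {R : Type*} [CommRing R] {Q : Ideal R} {x : R} :
    IsSMulRegular (R ⧸ (Q • ⊤ : Submodule R R)) x ↔ ∀ y, x * y ∈ Q → y ∈ Q := by
  have hQ : (Q • ⊤ : Submodule R R) = Q := by rw [smul_eq_mul, Ideal.mul_top]
  rw [hQ, isSMulRegular_iff_right_eq_zero_of_smul]
  constructor
  · intro h y hy
    rw [← Ideal.Quotient.eq_zero_iff_mem]
    refine h _ ?_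
    change Ideal.Quotient.mk Q (x • y) = 0
    rwa [Ideal.Quotient.eq_zero_iff_mem]
  · intro h y hy
    obtain ⟨y, rfl⟩ := Ideal.Quotient.mk_surjective y
    rw [Ideal.Quotient.eq_zero_iff_mem]
    refine h _ ?_
    rw [← Ideal.Quotient.eq_zero_iff_mem]
    exact hy

/-- In a Noetherian local ring, replacing the elements of a regular sequence by their powers
preserves irreducibility of the generated ideal. -/
lemma Ideal.infIrred_ofList_map_pow {R : Type*} [CommRing R] [IsLocalRing R] [IsNoetherianRing R]
    (t : ℕ) (as bs : List R) (hreg : IsWeaklyRegular R (as ++ bs))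
    (hirr : InfIrred (Ideal.ofList (as ++ bs)))
    (hprim : ∃ l : ℕ, maximalIdeal R ^ l ≤ Ideal.ofList (as ++ bs)) :
    InfIrred (Ideal.ofList (as.map (· ^ (t + 1)) ++ bs)) ∧
      ∃ l : ℕ, maximalIdeal R ^ l ≤ Ideal.ofList (as.map (· ^ (t + 1)) ++ bs) := by
  induction as generalizing bs with
  | nil => exact ⟨hirr, hprim⟩
  | cons a as ih =>
    have hm : ∀ r ∈ a :: as ++ bs, r ∈ maximalIdeal R := fun r hr =>
      le_maximalIdeal (Ideal.ne_top_of_infIrred hirr) (Ideal.subset_span hr)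
    set Q := Ideal.ofList (as ++ bs) with hQ
    have hQ1 : Ideal.ofList (a :: as ++ bs) = Q ⊔ Ideal.span {a} := by
      rw [List.cons_append, Ideal.ofList_cons, sup_comm]
    have hQ2 : Ideal.ofList (as ++ (bs ++ [a ^ (t + 1)])) = Q ⊔ Ideal.span {a ^ (t + 1)} := by
      rw [← List.append_assoc, Ideal.ofList_append, Ideal.ofList_singleton]
    have hQ3 : Ideal.ofList ((a :: as).map (· ^ (t + 1)) ++ bs) =
        Ideal.ofList (as.map (· ^ (t + 1)) ++ (bs ++ [a ^ (t + 1)])) := by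
      simp only [List.map_cons, List.cons_append, Ideal.ofList_cons, Ideal.ofList_append,
        Ideal.ofList_nil]
      rw [sup_bot_eq]
      ac_rfl
    -- Regular sequences permute in a Noetherian local ring, so `a` may come last. Its power then
    -- joins `bs`, which accumulates the elements already raised.
    have hperm : (a :: as ++ bs).Perm ((as ++ bs) ++ [a]) := by
      rw [List.cons_append]
      exact (List.perm_append_singleton _ _).symm
    have hreg' := IsLocalRing.isWeaklyRegular_of_perm_of_subset_maximalIdeal hreg hperm hm
    rw [isWeaklyRegular_append_iff, isWeaklyRegular_singleton_iff,
      isSMulRegular_quotient_smul_top_iff] at hreg'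
    obtain ⟨hreg1, hreg2⟩ := hreg'
    obtain ⟨l, hl⟩ := hprim
    rw [hQ1] at hirr hl
    rw [hQ3]
    refine ih _ ?_ ?_ ?_
    · rw [← List.append_assoc, isWeaklyRegular_append_iff, isWeaklyRegular_singleton_iff]
      exact ⟨hreg1, (isSMulRegular_quotient_smul_top_iff.mpr hreg2).pow _⟩
    · rw [hQ2]
      exact Ideal.infIrred_sup_span_pow hreg2 hl hirr t
    · rw [hQ2]
      refine ⟨l * (1 + (t + 1)), ?_⟩
      rw [pow_mul]
      refine (Ideal.pow_right_mono hl _).trans (Ideal.sup_pow_add_le_pow_sup_pow.trans ?_)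
      rw [pow_one, Ideal.span_singleton_pow]

/-- In a Gorenstein local ring, the powers of the maximal ideal contain irreducible ideals primary
to the maximal ideal. -/
lemma IsGorensteinLocal.exists_infIrred_le {R : Type u} [CommRing R] [IsLocalRing R]
    (h : IsGorensteinLocal R) (n : ℕ) :
    ∃ J : Ideal R, J ≤ maximalIdeal R ^ n ∧ InfIrred J ∧ ∃ l : ℕ, maximalIdeal R ^ l ≤ J := by
  obtain ⟨-, _, xs, hreg, _, hirr⟩ := h
  have hm : ∀ r ∈ xs, r ∈ maximalIdeal R := fun r hr =>
    le_maximalIdeal (Ideal.ne_top_of_infIrred hirr) (Ideal.subset_span hr)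
  have := Ideal.infIrred_ofList_map_pow n xs [] (by simpa using hreg.toIsWeaklyRegular)
    (by simpa using hirr)
    (by simpa using exists_maximalIdeal_pow_le_of_isArtinianRing_quotient (Ideal.ofList xs))
  refine ⟨_, ?_, this⟩
  rw [List.append_nil]
  refine Ideal.span_le.mpr fun r hr => ?_
  obtain ⟨a, ha, rfl⟩ := List.mem_map.mp hr
  exact Ideal.pow_le_pow_right (Nat.le_succ n) (Ideal.pow_mem_pow (hm a ha) _)

lemma Ideal.infIrred_comap {R S : Type*} [CommRing R] [CommRing S] {φ : R →+* S}
    (hφ : Function.Surjective φ) {J : Ideal S} (hJ : InfIrred J) : InfIrred (J.comap φ) := by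
  refine ⟨fun h => ?_, fun b c hbc => ?_⟩
  · rw [isMax_iff_eq_top, Ideal.comap_eq_top_iff] at h
    exact Ideal.ne_top_of_infIrred hJ h
  · have hker : RingHom.ker φ ≤ J.comap φ := Ideal.ker_le_comap φ
    have hb : (b.map φ).comap φ = b := by
      rw [Ideal.comap_map_of_surjective' _ hφ]
      exact sup_eq_left.mpr (hker.trans (hbc ▸ inf_le_left))
    have hc : (c.map φ).comap φ = c := by
      rw [Ideal.comap_map_of_surjective' _ hφ]
      exact sup_eq_left.mpr (hker.trans (hbc ▸ inf_le_right))
    have := @hJ.2 (b.map φ) (c.map φ)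
      (Ideal.comap_injective_of_surjective φ hφ (by rw [Ideal.comap_inf, hb, hc, hbc]))
    rcases this with h | h
    · exact Or.inl (by rw [← h, hb])
    · exact Or.inr (by rw [← h, hc])

/-- The quotient map of local rings pulls back the powers of the maximal ideal to
`I + m ^ n`. -/
lemma comap_mk_maximalIdeal_pow {T : Type*} [CommRing T] [IsLocalRing T] {I : Ideal T}
    [IsLocalRing (T ⧸ I)] (n : ℕ) :
    (maximalIdeal (T ⧸ I) ^ n).comap (Ideal.Quotient.mk I) = I ⊔ maximalIdeal T ^ n := by
  have := IsLocalHom.of_surjective (Ideal.Quotient.mk I) Ideal.Quotient.mk_surjective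
  have h : (maximalIdeal T).map (Ideal.Quotient.mk I) = maximalIdeal (T ⧸ I) := by
    rw [← maximalIdeal_comap (Ideal.Quotient.mk I), Ideal.map_comap_of_surjective _
      Ideal.Quotient.mk_surjective]
  rw [← h, ← Ideal.map_pow, Ideal.comap_map_of_surjective' _ Ideal.Quotient.mk_surjective,
    Ideal.mk_ker, sup_comm]

/-- Pull back a small irreducible ideal of the Gorenstein ring `(T/I)/K`. Because `K` is itself
inside the `N`-th power, the preimage in `T/I` stays there. -/
lemma IsApproximatelyGorensteinLocal.exists_infIrred_le {T : Type u} [CommRing T] [IsLocalRing T]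
    {I : Ideal T} (hI : IsApproximatelyGorensteinLocal (T ⧸ I)) (N : ℕ) :
    ∃ J : Ideal T, I ≤ J ∧ J ≤ I ⊔ maximalIdeal T ^ N ∧ InfIrred J ∧
      ∃ l : ℕ, maximalIdeal T ^ l ≤ J := by
  obtain ⟨_, _, h⟩ := hI
  obtain ⟨K, hK, hG⟩ := h N
  have hloc := hG.1
  obtain ⟨J, hJ, hirr, l, hl⟩ := hG.exists_infIrred_le N
  refine ⟨(J.comap (Ideal.Quotient.mk K)).comap (Ideal.Quotient.mk I), ?_, ?_, ?_, l, ?_⟩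
  · refine le_trans ?_ (Ideal.ker_le_comap _)
    rw [Ideal.mk_ker]
  · rw [← comap_mk_maximalIdeal_pow]
    refine Ideal.comap_mono ((Ideal.comap_mono hJ).trans ?_)
    rw [comap_mk_maximalIdeal_pow]
    exact sup_le hK le_rfl
  · exact Ideal.infIrred_comap Ideal.Quotient.mk_surjective
      (Ideal.infIrred_comap Ideal.Quotient.mk_surjective hirr)
  · refine le_trans (le_trans le_sup_right (comap_mk_maximalIdeal_pow (I := I) l).ge)
      (Ideal.comap_mono (le_trans (le_trans le_sup_right
        (comap_mk_maximalIdeal_pow (I := K) l).ge) (Ideal.comap_mono hl)))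

lemma IsApproximatelyGorensteinLocal.exists_isSocleChain {T : Type u} [CommRing T] [IsLocalRing T]
    {I : Ideal T} (hI : IsApproximatelyGorensteinLocal (T ⧸ I)) :
    ∃ (J : ℕ → Ideal T) (s : ℕ → T), IsSocleChain I J s := by
  let P := {J : Ideal T // I ≤ J ∧ InfIrred J ∧ ∃ l : ℕ, maximalIdeal T ^ l ≤ J}
  -- As `p` contains both `I` and some `m ^ l`, any ideal inside `I + m ^ max N l` lies below it.
  have step : ∀ (N : ℕ) (p : P), ∃ q : P, q.1 ≤ p.1 ∧ q.1 ≤ I ⊔ maximalIdeal T ^ N := by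
    rintro N ⟨J, hIJ, hJ, l, hl⟩
    obtain ⟨J', h1, h2, h3, h4⟩ := hI.exists_infIrred_le (max N l)
    exact ⟨⟨J', h1, h3, h4⟩,
      h2.trans (sup_le hIJ ((Ideal.pow_le_pow_right (le_max_right _ _)).trans hl)),
      h2.trans (sup_le_sup_left (Ideal.pow_le_pow_right (le_max_left _ _)) _)⟩
  choose next hnext1 hnext2 using step
  obtain ⟨J₀, h1, -, h3, h4⟩ := hI.exists_infIrred_le 0
  let J : ℕ → P := fun n => Nat.rec ⟨J₀, h1, h3, h4⟩ (fun n p => next n p) n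
  have hs : ∀ n, ∃ s, (J n).1.colon (maximalIdeal T : Set T) = (J n).1 ⊔ Ideal.span {s} :=
    fun n => by
      obtain ⟨l, hl⟩ := (J n).2.2.2
      exact Ideal.exists_socle_of_infIrred hl (J n).2.2.1
  choose s hs using hs
  exact ⟨fun n => (J n).1, s,
    { le := fun n => (J n).2.1
      antitone := antitone_nat_of_succ_le fun n => hnext1 n (J n)
      irreducible := fun n => (J n).2.2.1
      primary := fun n => (J n).2.2.2
      cofinal := fun N => ⟨N + 1, hnext2 N (J N)⟩
      socle := hs }⟩

end Chains

/-! ### Splitting off `R/J` when `J` is irreducible -/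

section Splitting

open IsLocalRing

/-- If the socle of `N` is at most one-dimensional, the submodule of `N` annihilated by an
`m`-primary ideal `K` has length at most that of `R ⧸ K`. -/
lemma length_torsionBySet_le {R : Type*} [CommRing R] [IsLocalRing R] [IsNoetherianRing R]
    {N : Type*} [AddCommGroup N] [Module R N] {s : N} (hs : ∀ y ∈ maximalIdeal R, y • s = 0)
    (hsoc : ∀ n : N, (∀ y ∈ maximalIdeal R, y • n = 0) → n ∈ Submodule.span R {s})
    (l : ℕ) (K : Ideal R) (hK : maximalIdeal R ^ l ≤ K) :
    Module.length R (Submodule.torsionBySet R N (K : Set R)) ≤ Module.length R (R ⧸ K) := by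
  -- Enlarge `K` to `L = K + (x)` with `x` in the socle modulo `K`. Multiplication by `x` on the
  -- `K`-torsion has kernel in the `L`-torsion and image in the socle of `N`, of length at most one,
  -- while passing from `R/L` to `R/K` adds at least one.
  induction K using WellFoundedGT.induction with
  | ind K ih =>
  by_cases hKtop : K = ⊤
  · have : Subsingleton (Submodule.torsionBySet R N (K : Set R)) := by
      refine subsingleton_of_forall_eq 0 fun n => Subtype.ext ?_
      simpa using (Submodule.mem_torsionBySet_iff _ _).mp n.2 ⟨1, by rw [hKtop]; trivial⟩
    rw [Module.length_eq_zero]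
    exact bot_le
  obtain ⟨x₀, hx1, hx2⟩ := Ideal.exists_mul_notMem_of_pow_le hK
    (fun h => hKtop ((Ideal.eq_top_iff_one _).mpr h))
  generalize x₀ * 1 = x at hx1 hx2
  set L := K ⊔ Ideal.span {x} with hL
  have hxL : x ∈ L := Ideal.mem_sup_right (Ideal.mem_span_singleton_self x)
  have hKL : K < L := lt_of_le_of_ne le_sup_left (fun h => hx1 (by rw [h]; exact hxL))
  have ihL := ih L hKL (hK.trans hKL.le)
  let μ : Submodule.torsionBySet R N (K : Set R) →ₗ[R] N :=
    (LinearMap.lsmul R N x) ∘ₗ (Submodule.torsionBySet R N (K : Set R)).subtype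
  have hμ := Module.length_eq_add_of_exact (LinearMap.ker μ).subtype μ.rangeRestrict
    (Submodule.subtype_injective _) μ.surjective_rangeRestrict (by
      rw [LinearMap.exact_iff, LinearMap.ker_rangeRestrict, Submodule.range_subtype])
  have hker : Module.length R (LinearMap.ker μ) ≤
      Module.length R (Submodule.torsionBySet R N (L : Set R)) := by
    refine Module.length_le_of_injective
      (LinearMap.codRestrict (Submodule.torsionBySet R N (L : Set R))
        ((Submodule.torsionBySet R N (K : Set R)).subtype ∘ₗ (LinearMap.ker μ).subtype) ?_) ?_
    · rintro ⟨⟨n, hn⟩, hn'⟩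
      rw [Submodule.mem_torsionBySet_iff]
      rintro ⟨a, ha⟩
      obtain ⟨c, hc⟩ := Ideal.mem_sup_span_singleton_iff.mp ha
      have h1 : (a - c * x) • n = 0 := (Submodule.mem_torsionBySet_iff _ _).mp hn ⟨_, hc⟩
      have h2 : x • n = 0 := hn'
      rw [sub_smul, mul_smul, h2, smul_zero, sub_zero] at h1
      exact h1
    · intro a b hab
      have h := congrArg Subtype.val hab
      rw [LinearMap.codRestrict_apply, LinearMap.codRestrict_apply] at h
      exact Subtype.ext (Subtype.ext h)
  have hrange : Module.length R (LinearMap.range μ) ≤ 1 := by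
    have hle : LinearMap.range μ ≤ Submodule.span R {s} := by
      rintro _ ⟨⟨n, hn⟩, rfl⟩
      refine hsoc _ fun y hy => ?_
      change y • x • n = 0
      rw [smul_smul]
      exact (Submodule.mem_torsionBySet_iff _ _).mp hn ⟨_, hx2 y hy⟩
    let q : (R ⧸ maximalIdeal R) →ₗ[R] Submodule.span R {s} :=
      (maximalIdeal R).liftQ (LinearMap.toSpanSingleton R _
        ⟨s, Submodule.mem_span_singleton_self s⟩) (fun y hy => Subtype.ext (hs y hy))
    have hq : Function.Surjective q := by
      rintro ⟨z, hz⟩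
      obtain ⟨a, rfl⟩ := Submodule.mem_span_singleton.mp hz
      exact ⟨Submodule.Quotient.mk a, rfl⟩
    have hsimple : IsSimpleModule R (R ⧸ maximalIdeal R) :=
      isSimpleModule_iff_isCoatom.mpr (Ideal.IsMaximal.out (I := maximalIdeal R))
    calc Module.length R (LinearMap.range μ) ≤ Module.length R (Submodule.span R {s}) :=
          Module.length_le_of_injective (Submodule.inclusion hle)
            (Submodule.inclusion_injective hle)
      _ ≤ Module.length R (R ⧸ maximalIdeal R) := Module.length_le_of_surjective q hq
      _ = 1 := Module.length_eq_one R _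
  let p : (R ⧸ K) →ₗ[R] (R ⧸ L) := Submodule.factor hKL.le
  have hp := Module.length_eq_add_of_exact (LinearMap.ker p).subtype p
    (Submodule.subtype_injective _) (Submodule.factor_surjective hKL.le)
    (LinearMap.exact_subtype_ker_map p)
  have hpos : 1 ≤ Module.length R (LinearMap.ker p) := by
    rw [Order.one_le_iff_pos, Module.length_pos_iff]
    refine ⟨⟨Submodule.Quotient.mk x, ?_⟩, 0, fun h => hx1 ?_⟩
    · rw [LinearMap.mem_ker]
      exact (Submodule.Quotient.mk_eq_zero _).mpr hxL
    · exact (Submodule.Quotient.mk_eq_zero _).mp (congrArg Subtype.val h)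
  rw [hμ, hp, add_comm]
  exact add_le_add (hrange.trans hpos) (hker.trans ihL)

/-- Let `J` be an irreducible `m`-primary ideal with socle generator `s`. An element of a
finitely generated `R ⧸ J`-module which is not killed by `s` generates a free direct summand. -/
lemma exists_linearMap_eq_one_of_socle {R : Type*} [CommRing R] [IsLocalRing R]
    [IsNoetherianRing R] {J : Ideal R} {l : ℕ} (hl : maximalIdeal R ^ l ≤ J) {s : R}
    (hJ : J ≠ ⊤) (hs : J.colon (maximalIdeal R : Set R) = J ⊔ Ideal.span {s})
    {N : Type*} [AddCommGroup N] [Module R N] [Module.Finite R N]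
    (hN : ∀ a ∈ J, ∀ n : N, a • n = 0) {f : N} (hf : s • f ≠ 0) :
    ∃ φ : N →ₗ[R] R ⧸ J, φ f = 1 := by
  obtain ⟨-, hs2⟩ := Ideal.socle_of_colon_eq hl hJ hs
  have hsm : ∀ y ∈ maximalIdeal R, y * s ∈ J := fun y hy => by
    have : s ∈ J.colon (maximalIdeal R : Set R) :=
      hs ▸ Ideal.mem_sup_right (Ideal.mem_span_singleton_self s)
    simpa [mul_comm] using Submodule.mem_colon.mp this y hy
  -- By maximality every nonzero submodule of `N/N₀` contains the class of `s • f`. Hence the socle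
  -- of `N/N₀` is spanned by that class and the length bound applies.
  obtain ⟨N₀, hN₀, hmax⟩ := set_has_maximal_iff_noetherian.mpr
    (inferInstance : IsNoetherian R N) {P : Submodule R N | s • f ∉ P} ⟨⊥, by simpa using hf⟩
  have hN₀' : N₀.mkQ (s • f) ≠ 0 := fun h =>
    hN₀ ((Submodule.Quotient.mk_eq_zero N₀).mp h)
  have hsimple : ∀ n : N ⧸ N₀, n ≠ 0 → ∃ a : R, a • n = N₀.mkQ (s • f) := fun n hn => by
    obtain ⟨n, rfl⟩ := N₀.mkQ_surjective n
    have hnN : n ∉ N₀ := fun h => hn (by simpa using h)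
    have hlt : N₀ < N₀ ⊔ Submodule.span R {n} := lt_of_le_of_ne le_sup_left fun h =>
      hnN (h ▸ Submodule.mem_sup_right (Submodule.mem_span_singleton_self n))
    have hmem : s • f ∈ N₀ ⊔ Submodule.span R {n} := by
      by_contra h
      exact hmax _ h hlt
    obtain ⟨z, hz, w, hw, hzw⟩ := Submodule.mem_sup.mp hmem
    obtain ⟨a, rfl⟩ := Submodule.mem_span_singleton.mp hw
    exact ⟨a, by rw [← hzw, map_add, map_smul, Submodule.mkQ_apply N₀ z,
      (Submodule.Quotient.mk_eq_zero N₀).mpr hz, zero_add]⟩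
  have hN' : ∀ a ∈ J, ∀ n : N ⧸ N₀, a • n = 0 := fun a ha n => by
    obtain ⟨n, rfl⟩ := N₀.mkQ_surjective n
    rw [← map_smul, hN a ha, map_zero]
  have hlen := length_torsionBySet_le (N := N ⧸ N₀) (s := N₀.mkQ (s • f))
    (fun y hy => by rw [← map_smul, smul_smul, hN _ (hsm y hy), map_zero])
    (fun n hn => by
      by_cases hn0 : n = 0
      · rw [hn0]; exact zero_mem _
      obtain ⟨a, ha⟩ := hsimple n hn0
      have hu : IsUnit a := by
        by_contra hu
        exact hN₀' (by rw [← ha, hn a ((mem_maximalIdeal a).mpr hu)])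
      obtain ⟨b, hb⟩ := hu.exists_left_inv
      rw [Submodule.mem_span_singleton]
      exact ⟨b, by rw [← ha, smul_smul, hb, one_smul]⟩) l J hl
  rw [(Submodule.eq_top_iff'.mpr fun n => (Submodule.mem_torsionBySet_iff _ _).mpr
    fun a => hN' a.1 a.2 n : Submodule.torsionBySet R (N ⧸ N₀) (J : Set R) = ⊤),
    Module.length_top] at hlen
  let g : (R ⧸ J) →ₗ[R] N ⧸ N₀ :=
    J.liftQ (LinearMap.toSpanSingleton R _ (N₀.mkQ f)) (fun a ha => hN' a ha _)
  have hg1 : g 1 = N₀.mkQ f := one_smul R (N₀.mkQ f)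
  have hginj : Function.Injective g := by
    rw [← LinearMap.ker_eq_bot, LinearMap.ker_eq_bot']
    intro x hx
    obtain ⟨x, rfl⟩ := Ideal.Quotient.mk_surjective x
    have hx' : x • N₀.mkQ f = 0 := hx
    rw [Ideal.Quotient.eq_zero_iff_mem]
    by_contra hxJ
    obtain ⟨a, ha⟩ := Ideal.mem_sup_span_singleton_iff.mp (hs2 x hxJ)
    have := hN' _ ha (N₀.mkQ f)
    rw [sub_smul, mul_smul, hx', smul_zero, sub_zero, ← map_smul] at this
    exact hN₀' this
  have hfin : Module.length R (R ⧸ J) ≠ ⊤ := by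
    have : Nontrivial (R ⧸ J) := Ideal.Quotient.nontrivial_iff.mpr hJ
    have : IsLocalRing (R ⧸ J) :=
      IsLocalRing.of_surjective' (Ideal.Quotient.mk J) Ideal.Quotient.mk_surjective
    have : IsArtinianRing (R ⧸ J) := by
      rw [isArtinianRing_iff_isNilpotent_maximalIdeal]
      refine ⟨l, ?_⟩
      rw [Ideal.zero_eq_bot, eq_bot_iff,
        ← Ideal.map_comap_of_surjective (Ideal.Quotient.mk J) Ideal.Quotient.mk_surjective
          (maximalIdeal (R ⧸ J) ^ l), comap_mk_maximalIdeal_pow, Ideal.map_le_iff_le_comap]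
      refine (sup_le le_rfl hl).trans ?_
      rw [← RingHom.ker_eq_comap_bot, Ideal.mk_ker]
    have : IsArtinian R (R ⧸ J) :=
      isArtinian_of_surjective_algebraMap (S := R) (R := R ⧸ J) Ideal.Quotient.mk_surjective
    exact Module.length_ne_top
  -- An injection from a module of finite length into one of no greater length is onto. The inverse
  -- of `g` then gives the required retraction.
  have hsurj : Function.Surjective g := by
    have h := Module.length_eq_add_of_exact g (LinearMap.range g).mkQ hginj
      (Submodule.mkQ_surjective _) (LinearMap.exact_map_mkQ_range g)
    rw [h] at hlen
    have h0 : Module.length R ((N ⧸ N₀) ⧸ LinearMap.range g) = 0 := by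
      have := (ENat.add_le_add_iff_left hfin).mp (hlen.trans (add_zero _).ge)
      exact le_antisymm this bot_le
    rw [Module.length_eq_zero_iff, Submodule.Quotient.subsingleton_iff] at h0
    exact LinearMap.range_eq_top.mp h0
  let e := LinearEquiv.ofBijective g ⟨hginj, hsurj⟩
  refine ⟨e.symm.toLinearMap ∘ₗ N₀.mkQ, ?_⟩
  change e.symm (N₀.mkQ f) = 1
  rw [LinearEquiv.symm_apply_eq]
  exact hg1.symm

end Splitting

/-! ### Approximating linear maps -/

section Approximation

open IsLocalRing

/-- Existence of a linear map to `A` with a prescribed value can be tested modulo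
arbitrarily small submodules of `A`, over a Noetherian local ring. -/
lemma exists_linearMap_apply_eq_of_forall_pow {R M A : Type u} [CommRing R] [IsLocalRing R]
    [IsNoetherianRing R] [AddCommGroup M] [Module R M] [Module.Finite R M] [AddCommGroup A]
    [Module R A] [Module.Finite R A] {f : M} {a : A}
    (H : ∀ N : ℕ, ∃ (B : Type u) (_ : AddCommGroup B) (_ : Module R B) (π : A →ₗ[R] B),
      Function.Surjective π ∧ LinearMap.ker π ≤ maximalIdeal R ^ N • (⊤ : Submodule R A) ∧
      ∃ φ : M →ₗ[R] B, φ f = π a) :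
    ∃ φ : M →ₗ[R] A, φ f = a := by
  obtain ⟨q, h, hh⟩ := Module.Finite.exists_fin' R M
  obtain ⟨p, r, hr⟩ := Submodule.fg_iff_exists_fin_generating_family.mp
    (IsNoetherian.noetherian (LinearMap.ker h))
  obtain ⟨v, rfl⟩ := hh f
  -- With `h : R^q → M` presenting `M`, a map `M → A` taking `f` to `a` is a `ψ` on `R^q` vanishing
  -- on the relations `r k` with `ψ v = a`, that is, a preimage of `(0, a)` under `Λ`.
  let Λ : ((Fin q → R) →ₗ[R] A) →ₗ[R] (Fin p → A) × A :=
    LinearMap.prod (LinearMap.pi fun k => LinearMap.applyₗ (r k)) (LinearMap.applyₗ v)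
  have hrange : ((0, a) : (Fin p → A) × A) ∈ LinearMap.range Λ := by
    -- Krull's intersection theorem for the cokernel of `Λ`: it suffices to reach `(0, a)` modulo
    -- each power of the maximal ideal, which a lift of `φ ∘ h` along `π` does.
    rw [← Submodule.Quotient.mk_eq_zero, ← Submodule.mem_bot R,
      ← Ideal.iInf_pow_smul_eq_bot_of_isLocalRing (maximalIdeal R)
        (Ideal.IsPrime.ne_top inferInstance), Submodule.mem_iInf]
    intro N
    obtain ⟨B, _, _, π, hπ, hker, φ, hφ⟩ := H N
    obtain ⟨ψ, hψ⟩ := Module.projective_lifting_property π (φ ∘ₗ h) hπ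
    have hψ' : ∀ x, π (ψ x) = φ (h x) := fun x => LinearMap.congr_fun hψ x
    have hmem : ∀ (X : Type u) [AddCommGroup X] [Module R X] (i : A →ₗ[R] X) (b : A), π b = 0 →
        i b ∈ maximalIdeal R ^ N • (⊤ : Submodule R X) := fun X _ _ i b hb => by
      have h1 := Submodule.mem_map_of_mem (f := i) (hker (LinearMap.mem_ker.mpr hb))
      rw [Submodule.map_smul''] at h1
      exact Submodule.smul_mono le_rfl le_top h1
    have hr0 : ∀ k, h (r k) = 0 := fun k =>
      LinearMap.mem_ker.mp (hr ▸ Submodule.subset_span ⟨k, rfl⟩)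
    have hdiff : ((0, a) : (Fin p → A) × A) - Λ ψ ∈
        maximalIdeal R ^ N • (⊤ : Submodule R ((Fin p → A) × A)) := by
      have hdecomp : ((0, a) : (Fin p → A) × A) - Λ ψ =
          (∑ k, (LinearMap.inl R (Fin p → A) A ∘ₗ LinearMap.single R (fun _ => A) k)
            (-(ψ (r k)))) + LinearMap.inr R (Fin p → A) A (a - ψ v) := by
        simp only [LinearMap.comp_apply]
        rw [← map_sum]
        refine Prod.ext ?_ ?_
        · ext k
          simp [Λ, Prod.fst_sum, Finset.sum_apply, Pi.single_apply]
        · simp [Λ, Prod.snd_sum]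
      rw [hdecomp]
      refine add_mem (sum_mem fun k _ => hmem _ _ _ ?_) (hmem _ _ _ ?_)
      · rw [map_neg, hψ', hr0, map_zero, neg_zero]
      · rw [map_sub, hψ', hφ, sub_self]
    have h2 := Submodule.mem_map_of_mem (f := (LinearMap.range Λ).mkQ) hdiff
    rw [Submodule.map_smul'', map_sub, Submodule.mkQ_apply, Submodule.mkQ_apply,
      (Submodule.Quotient.mk_eq_zero _).mpr (LinearMap.mem_range_self Λ ψ), sub_zero] at h2
    exact Submodule.smul_mono le_rfl le_top h2
  obtain ⟨ψ, hψ⟩ := hrange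
  have hψr : ∀ k, ψ (r k) = 0 := fun k => congrFun (congrArg Prod.fst hψ) k
  have hψv : ψ v = a := congrArg Prod.snd hψ
  have hle : LinearMap.ker h ≤ LinearMap.ker ψ := by
    rw [← hr, Submodule.span_le]
    rintro _ ⟨k, rfl⟩
    exact hψr k
  refine ⟨(LinearMap.ker h).liftQ ψ hle ∘ₗ (h.quotKerEquivOfSurjective hh).symm.toLinearMap, ?_⟩
  have : (h.quotKerEquivOfSurjective hh).symm (h v) = Submodule.Quotient.mk v := by
    rw [LinearEquiv.symm_apply_eq]; rfl
  simp [this, hψv]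

end Approximation

/-! ### The splitting criterion along a chain -/

section SocleChain

open IsLocalRing

variable {T : Type u} [CommRing T] {I : Ideal T}

/-- The composite `I → T/J' → T/J` kills `I * J` but sends `s * f` to the class of `s`, which is
nonzero. -/
lemma mul_notMem_of_linearMap_eq_one {J' J : Ideal T} (hJ : J' ≤ J) {s f : T} (hs : s ∉ J)
    (hf : f ∈ I) (h : ∃ φ : I →ₗ[T] T ⧸ J', φ ⟨f, hf⟩ = 1) : s * f ∉ I * J := by
  obtain ⟨φ, hφ⟩ := h
  intro hsf
  have h1 : s • (⟨f, hf⟩ : I) ∈ J • (⊤ : Submodule T I) := by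
    rw [Submodule.mem_smul_top_iff]
    change s * f ∈ J * I
    rwa [mul_comm J I]
  have h2 := Submodule.mem_map_of_mem
    (f := (Submodule.factor hJ : (T ⧸ J') →ₗ[T] T ⧸ J) ∘ₗ φ) h1
  rw [Submodule.map_smul'', LinearMap.comp_apply, map_smul, hφ, map_smul] at h2
  have h3 : (J • Submodule.map ((Submodule.factor hJ : (T ⧸ J') →ₗ[T] T ⧸ J) ∘ₗ φ) ⊤) = ⊥ := by
    rw [eq_bot_iff, Submodule.smul_le]
    intro a ha n _
    obtain ⟨n, rfl⟩ := Ideal.Quotient.mk_surjective n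
    change Ideal.Quotient.mk J (a * n) = 0
    rw [Ideal.Quotient.eq_zero_iff_mem]
    exact J.mul_mem_right _ ha
  rw [h3, Submodule.mem_bot] at h2
  have h4 : Ideal.Quotient.mk J (s * 1) = 0 := h2
  rw [mul_one, Ideal.Quotient.eq_zero_iff_mem] at h4
  exact hs h4

lemma mem_socleColon_iff {J : Ideal T} {s f : T} :
    f ∈ socleColon I J s ↔ f ∈ I ∧ s * f ∈ I * J := by
  rw [socleColon, Submodule.mem_inf, Submodule.mem_colon_singleton, smul_eq_mul, mul_comm f s,
    and_comm]

variable [IsLocalRing T] {J : ℕ → Ideal T} {s : ℕ → T}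

lemma IsSocleChain.notMem (h : IsSocleChain I J s) (i : ℕ) : s i ∉ J i := by
  obtain ⟨l, hl⟩ := h.primary i
  exact (Ideal.socle_of_colon_eq hl (Ideal.ne_top_of_infIrred (h.irreducible i)) (h.socle i)).1

variable [IsNoetherianRing T]

lemma IsSocleChain.exists_linearMap (h : IsSocleChain I J s) {f : T} (hf : f ∈ I) (i : ℕ)
    (hsf : s i * f ∉ I * J i) : ∃ φ : I →ₗ[T] T ⧸ J i, φ ⟨f, hf⟩ = 1 := by
  obtain ⟨l, hl⟩ := h.primary i
  let P : Submodule T I := J i • ⊤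
  obtain ⟨φ, hφ⟩ := exists_linearMap_eq_one_of_socle hl
    (Ideal.ne_top_of_infIrred (h.irreducible i)) (h.socle i) (N := I ⧸ P)
    (f := P.mkQ ⟨f, hf⟩)
    (fun a ha n => by
      obtain ⟨n, rfl⟩ := P.mkQ_surjective n
      rw [← map_smul]
      exact (Submodule.Quotient.mk_eq_zero P).mpr (Submodule.smul_mem_smul ha trivial))
    (fun h0 => hsf <| by
      rw [← map_smul] at h0
      have := (Submodule.Quotient.mk_eq_zero P).mp h0
      rw [Submodule.mem_smul_top_iff] at this
      rw [mul_comm I]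
      exact this)
  exact ⟨φ ∘ₗ P.mkQ, hφ⟩

/-- If `f` is not in the `j`-th ideal, some `I → T/J j` takes `f` to `1`; reducing it to `T/J i`
shows that `f` is not in the `i`-th ideal. -/
lemma IsSocleChain.monotone_socleColon (h : IsSocleChain I J s) :
    Monotone (fun i => socleColon I (J i) (s i)) := by
  intro i j hij f hf
  obtain ⟨hfI, hf⟩ := mem_socleColon_iff.mp hf
  refine mem_socleColon_iff.mpr ⟨hfI, ?_⟩
  by_contra hfj
  exact mul_notMem_of_linearMap_eq_one (h.antitone hij) (h.notMem i) hfI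
    (h.exists_linearMap hfI j hfj) hf

/-- `T ⧸ I → I ⧸ I ^ 2`, `1 ↦ f` splits if and only if `f` lies in no `socleColon`. -/
lemma IsSocleChain.exists_linearMap_iff (h : IsSocleChain I J s) {f : T} (hf : f ∈ I) :
    (∃ φ : I →ₗ[T] T ⧸ I, φ ⟨f, hf⟩ = 1) ↔ f ∉ ⨆ i, socleColon I (J i) (s i) := by
  rw [Submodule.mem_iSup_of_directed _ h.monotone_socleColon.directed_le]
  simp only [mem_socleColon_iff, hf, true_and, not_exists]
  refine ⟨fun hφ i => mul_notMem_of_linearMap_eq_one (h.le i) (h.notMem i) hf hφ, fun hs => ?_⟩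
  -- Cofinality makes the kernel `J i / I` of `T/I → T/J i` lie in `m ^ N (T/I)`.
  refine exists_linearMap_apply_eq_of_forall_pow fun N => ?_
  obtain ⟨i, hi⟩ := h.cofinal N
  refine ⟨T ⧸ J i, inferInstance, inferInstance, Submodule.factor (h.le i),
    Submodule.factor_surjective (h.le i), fun x hx => ?_, h.exists_linearMap hf i (hs i)⟩
  obtain ⟨x, rfl⟩ := Ideal.Quotient.mk_surjective x
  have hx' : x ∈ J i := Ideal.Quotient.eq_zero_iff_mem.mp hx
  obtain ⟨y, hy, z, hz, rfl⟩ := Submodule.mem_sup.mp (hi hx')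
  rw [map_add, Ideal.Quotient.eq_zero_iff_mem.mpr hy, zero_add]
  have : Ideal.Quotient.mk I z = z • (1 : T ⧸ I) := by
    rw [Algebra.smul_def, mul_one]; rfl
  rw [this]
  exact Submodule.smul_mem_smul hz trivial

end SocleChain

/-! ### Tor against `T/(f)` -/

section Tor

open CategoryTheory.Limits MonoidalCategory

lemma ChainComplex.exactAt_one_iff_mono {C : Type*} [Category* C] [Abelian C]
    (K : ChainComplex C ℕ) (hK : IsZero (K.X 2)) : K.ExactAt 1 ↔ Mono (K.d 1 0) := by
  rw [K.exactAt_iff' 2 1 0 (by simp) (by simp)]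
  exact ShortComplex.exact_iff_mono _ (hK.eq_of_src _ _)

lemma HomologicalComplex.exactAt_of_isZero {C ι : Type*} [Category* C] [Abelian C]
    {c : ComplexShape ι} (K : HomologicalComplex C c) (i : ι) (hK : IsZero (K.X i)) :
    K.ExactAt i :=
  ShortComplex.exact_of_isZero_X₂ _ hK

lemma CategoryTheory.Functor.mono_map_iso_comp_comp_iso_iff {C D : Type*} [Category* C]
    [Category* D] (F : C ⥤ D) {X Y X' Y' : C} (e : X' ≅ X) (g : X ⟶ Y) (e' : Y' ≅ Y) :
    Mono (F.map (e.hom ≫ g ≫ e'.inv)) ↔ Mono (F.map g) := by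
  rw [F.map_comp, F.map_comp, mono_comp_iff_of_isIso, mono_comp_iff_of_mono]

variable {T : Type u} [CommRing T]

/-- The complex `T → T` given by multiplication by `f`, in degrees `1` and `0`. -/
noncomputable def koszulComplexOne (f : T) : ChainComplex (ModuleCat.{u} T) ℕ :=
  HomologicalComplex.double (ModuleCat.ofHom (LinearMap.lsmul T T f))
    (show (ComplexShape.down ℕ).Rel 1 0 from rfl)

lemma koszulComplexOne_isZero (f : T) (n : ℕ) : IsZero ((koszulComplexOne f).X (n + 2)) :=
  HomologicalComplex.isZero_double_X _ _ _ (by lia) (by lia)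

/-- The degree `1` part of `koszulComplexOne`. -/
noncomputable def koszulComplexOneXOne (f : T) : (koszulComplexOne f).X 1 ≅ ModuleCat.of T T :=
  HomologicalComplex.doubleXIso₀ _ _

/-- The degree `0` part of `koszulComplexOne`. -/
noncomputable def koszulComplexOneXZero (f : T) : (koszulComplexOne f).X 0 ≅ ModuleCat.of T T :=
  HomologicalComplex.doubleXIso₁ _ _ one_ne_zero

lemma koszulComplexOne_d (f : T) : (koszulComplexOne f).d 1 0 =
    (koszulComplexOneXOne f).hom ≫ ModuleCat.ofHom (LinearMap.lsmul T T f) ≫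
      (koszulComplexOneXZero f).inv :=
  HomologicalComplex.double_d _ _ _

lemma ofHom_lsmul_comp_mkQ (f : T) : ModuleCat.ofHom (LinearMap.lsmul T T f) ≫
    ModuleCat.ofHom (Ideal.span {f}).mkQ = 0 := by
  ext
  exact (Submodule.Quotient.mk_eq_zero _).mpr
    (Ideal.mul_mem_right _ _ (Ideal.mem_span_singleton_self f))

lemma isSMulRegular_iff_injective_lTensor (M : Type*) [AddCommGroup M] [Module T M] (f : T) :
    Function.Injective ((LinearMap.lsmul T T f).lTensor M) ↔ IsSMulRegular M f := by
  have h : ∀ x, TensorProduct.rid T M ((LinearMap.lsmul T T f).lTensor M x) =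
      f • TensorProduct.rid T M x := fun x => by
    induction x using TensorProduct.induction_on with
    | zero => simp
    | tmul m a => simp [mul_smul]
    | add x y hx hy => simp only [map_add, smul_add, hx, hy]
  constructor
  · intro hinj a b hab
    obtain ⟨x, rfl⟩ := (TensorProduct.rid T M).surjective a
    obtain ⟨y, rfl⟩ := (TensorProduct.rid T M).surjective b
    exact congrArg _ (hinj ((TensorProduct.rid T M).injective (by rw [h, h]; exact hab)))
  · intro hreg x y hxy
    exact (TensorProduct.rid T M).injective (hreg (by
      change f • _ = f • _
      rw [← h, ← h, hxy]))

/-- The resolution `0 → T → T → T ⧸ (f) → 0` for a nonzerodivisor `f`. -/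
noncomputable def quotientSpanSingletonResolution {f : T} (hf : f ∈ nonZeroDivisors T) :
    ProjectiveResolution (ModuleCat.of T (T ⧸ Ideal.span {f})) where
  complex := koszulComplexOne f
  projective n := by
    match n with
    | 0 => exact Projective.of_iso (koszulComplexOneXZero f).symm inferInstance
    | 1 => exact Projective.of_iso (koszulComplexOneXOne f).symm inferInstance
    | n + 2 => exact (koszulComplexOne_isZero f n).projective
  π := (ChainComplex.toSingle₀Equiv _ _).symm
    ⟨(koszulComplexOneXZero f).hom ≫ ModuleCat.ofHom (Ideal.span {f}).mkQ, by
      rw [koszulComplexOne_d, Category.assoc, Category.assoc, Iso.inv_hom_id_assoc,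
        ofHom_lsmul_comp_mkQ, comp_zero]⟩
  quasiIso := ⟨fun n => by
    match n with
    | 0 =>
      rw [ChainComplex.quasiIsoAt₀_iff, ShortComplex.quasiIso_iff_of_zeros']
      · refine (ShortComplex.exact_and_epi_g_iff_of_iso
          (S₂ := ShortComplex.mk _ _ (ofHom_lsmul_comp_mkQ f)) ?_).2 ⟨?_, ?_⟩
        · refine ShortComplex.isoMk (koszulComplexOneXOne f) (koszulComplexOneXZero f)
            (Iso.refl _) ?_ ?_
          · have h : (koszulComplexOneXOne f).hom ≫ ModuleCat.ofHom (LinearMap.lsmul T T f) =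
                (koszulComplexOne f).d 1 0 ≫ (koszulComplexOneXZero f).hom := by
              simp [koszulComplexOne_d]
            exact h
          · simp only [HomologicalComplex.shortComplexFunctor'_map_τ₂,
              ChainComplex.toSingle₀Equiv_symm_apply_f_zero]
            exact (Category.comp_id _).symm
        · rw [ShortComplex.moduleCat_exact_iff]
          intro x hx
          obtain ⟨a, ha⟩ := Ideal.mem_span_singleton'.mp ((Submodule.Quotient.mk_eq_zero _).mp hx)
          exact ⟨a, by rw [← ha, mul_comm]; rfl⟩
        · exact (ModuleCat.epi_iff_surjective _).mpr (Submodule.mkQ_surjective _)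
      · exact (koszulComplexOne f).shape 0 0 (by simp)
      all_goals rfl
    | 1 =>
      rw [quasiIsoAt_iff_exactAt' _ _ (ChainComplex.exactAt_succ_single_obj _ _),
        ChainComplex.exactAt_one_iff_mono _ (koszulComplexOne_isZero f 0), koszulComplexOne_d]
      have : Mono (ModuleCat.ofHom (LinearMap.lsmul T T f)) := by
        rw [ModuleCat.mono_iff_injective]
        exact fun a b hab => (mul_cancel_left_mem_nonZeroDivisors hf).mp hab
      infer_instance
    | n + 2 =>
      rw [quasiIsoAt_iff_exactAt' _ _ (ChainComplex.exactAt_succ_single_obj _ _)]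
      exact HomologicalComplex.exactAt_of_isZero _ _ (koszulComplexOne_isZero f n)⟩

/-- Tensoring the length-one resolution of `T/(f)` with `M` leaves `f : M → M`: its kernel is the
first Tor, and the higher ones vanish. -/
lemma isZero_tor_quotient_span_singleton_iff {f : T} (hf : f ∈ nonZeroDivisors T)
    (M : ModuleCat.{u} T) :
    (∀ i : ℕ, 0 < i → IsZero (((Tor (ModuleCat.{u} T) i).obj M).obj
      (ModuleCat.of T (T ⧸ Ideal.span {f})))) ↔ IsSMulRegular M f := by
  let F := (tensoringLeft (ModuleCat.{u} T)).obj M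
  let K := (F.mapHomologicalComplex _).obj (koszulComplexOne f)
  have hK : ∀ n, IsZero (K.X (n + 2)) := fun n => F.map_isZero (koszulComplexOne_isZero f n)
  have hTor : ∀ i, IsZero (((Tor (ModuleCat.{u} T) i).obj M).obj
      (ModuleCat.of T (T ⧸ Ideal.span {f}))) ↔ K.ExactAt i := fun i => by
    rw [HomologicalComplex.exactAt_iff_isZero_homology]
    exact ((quotientSpanSingletonResolution hf).isoLeftDerivedObj F i).isZero_iff
  have hreg : K.ExactAt 1 ↔ IsSMulRegular M f := by
    rw [ChainComplex.exactAt_one_iff_mono K (hK 0), ← isSMulRegular_iff_injective_lTensor]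
    have hd : Mono (K.d 1 0) ↔ Mono (F.map ((koszulComplexOne f).d 1 0)) := Iff.rfl
    rw [hd, koszulComplexOne_d, Functor.mono_map_iso_comp_comp_iso_iff]
    exact ModuleCat.mono_iff_injective _
  rw [← hreg, ← hTor]
  refine ⟨fun h => h 1 one_pos, fun h i hi => ?_⟩
  match i, hi with
  | 1, _ => exact h
  | n + 2, _ =>
    rw [hTor]
    exact HomologicalComplex.exactAt_of_isZero _ _ (hK n)

end Tor

/-! ### Weak liftability as a splitting problem -/

section Liftable

open TensorProduct

variable {T : Type u} [CommRing T]

lemma one_tmul_eq_zero_iff {f : T} {M : Type*} [AddCommGroup M] [Module T M] (m : M) :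
    (1 : T ⧸ Ideal.span {f}) ⊗ₜ[T] m = 0 ↔ ∃ y, f • y = m := by
  rw [← (quotTensorEquivQuotSMul M (Ideal.span {f})).map_eq_zero_iff,
    ← map_one (Ideal.Quotient.mk (Ideal.span {f})), quotTensorEquivQuotSMul_mk_tmul, one_smul,
    Submodule.Quotient.mk_eq_zero, Submodule.ideal_span_singleton_smul,
    Submodule.mem_smul_pointwise_iff_exists]
  simp

lemma one_tmul_surjective {f : T} {M : Type*} [AddCommGroup M] [Module T M]
    (x : (T ⧸ Ideal.span {f}) ⊗[T] M) : ∃ m : M, (1 : T ⧸ Ideal.span {f}) ⊗ₜ[T] m = x := by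
  induction x using TensorProduct.induction_on with
  | zero => exact ⟨0, tmul_zero _ _⟩
  | tmul a m =>
    obtain ⟨a, rfl⟩ := Ideal.Quotient.mk_surjective a
    refine ⟨a • m, ?_⟩
    rw [← smul_tmul, Algebra.smul_def, mul_one]
    rfl
  | add x y hx hy =>
    obtain ⟨m, rfl⟩ := hx
    obtain ⟨n, rfl⟩ := hy
    exact ⟨m + n, tmul_add _ _ _⟩

lemma exists_linearMap_eq_one_of_isWeaklyLiftable {I : Ideal T} {f : T} (hf : f ∈ I)
    (hreg : f ∈ nonZeroDivisors T) [Module (T ⧸ Ideal.span {f}) (T ⧸ I)]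
    [IsScalarTower T (T ⧸ Ideal.span {f}) (T ⧸ I)]
    (h : IsWeaklyLiftable T (T ⧸ Ideal.span {f}) (T ⧸ I)) :
    ∃ φ : I →ₗ[T] T ⧸ I, φ ⟨f, hf⟩ = 1 := by
  obtain ⟨N, _, _, -, M, -, htor, ⟨e⟩⟩ := h
  have hM : IsSMulRegular M f := (isZero_tor_quotient_span_singleton_iff hreg M).mp htor
  obtain ⟨w, hw⟩ := one_tmul_surjective (e (1, 0))
  have hsmul : ∀ (a : T) (m : M), (1 : T ⧸ Ideal.span {f}) ⊗ₜ[T] (a • m) =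
      Ideal.Quotient.mk (Ideal.span {f}) a • ((1 : T ⧸ Ideal.span {f}) ⊗ₜ[T] m) :=
    fun a m => by
      rw [← smul_tmul, smul_tmul', Algebra.smul_def]
      rfl
  have hmk : ∀ (a : T) (x : T ⧸ I), Ideal.Quotient.mk (Ideal.span {f}) a • x = a • x :=
    fun a x => algebraMap_smul (T ⧸ Ideal.span {f}) a x
  let π : M →ₗ[T] T ⧸ I :=
    { toFun := fun m => (e.symm (1 ⊗ₜ m)).1
      map_add' := fun m n => by rw [tmul_add, map_add, Prod.fst_add]
      map_smul' := fun a m => by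
        rw [hsmul, map_smul, Prod.smul_fst, hmk]
        rfl }
  let g : M →ₗ[T] M := LinearMap.lsmul T M f
  have hg : Function.Injective g := hM
  -- `I` kills `(1, 0)`, so `I w ⊆ f M`. Regularity of `f` makes the division by `f` defining `δ`
  -- well defined and linear.
  have hdiv : ∀ a : I, LinearMap.toSpanSingleton T M w a ∈ LinearMap.range g := fun a => by
    change ∃ y, f • y = (a : T) • w
    rw [← one_tmul_eq_zero_iff, hsmul, hw, ← map_smul]
    have : Ideal.Quotient.mk (Ideal.span {f}) (a : T) • ((1, 0) : (T ⧸ I) × N) = 0 := by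
      refine Prod.ext ?_ (smul_zero _)
      rw [Prod.smul_fst, hmk, Algebra.smul_def, mul_one]
      exact Ideal.Quotient.eq_zero_iff_mem.mpr a.2
    rw [this, map_zero]
  let δ : I →ₗ[T] M := (LinearEquiv.ofInjective g hg).symm.toLinearMap ∘ₗ
    LinearMap.codRestrict (LinearMap.range g)
      (LinearMap.toSpanSingleton T M w ∘ₗ I.subtype) hdiv
  have hδ : δ ⟨f, hf⟩ = w := by
    change (LinearEquiv.ofInjective g hg).symm _ = w
    rw [LinearEquiv.symm_apply_eq]
    rfl
  refine ⟨π ∘ₗ δ, ?_⟩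
  rw [LinearMap.comp_apply, hδ]
  change (e.symm (1 ⊗ₜ w)).1 = 1
  rw [hw, e.symm_apply_apply]

lemma isWeaklyLiftable_of_linearMap_eq_one [IsNoetherianRing T] {I : Ideal T} {f : T} (hf : f ∈ I)
    (hreg : f ∈ nonZeroDivisors T) [Module (T ⧸ Ideal.span {f}) (T ⧸ I)]
    [IsScalarTower T (T ⧸ Ideal.span {f}) (T ⧸ I)]
    (h : ∃ φ : I →ₗ[T] T ⧸ I, φ ⟨f, hf⟩ = 1) :
    IsWeaklyLiftable T (T ⧸ Ideal.span {f}) (T ⧸ I) := by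
  obtain ⟨φ, hφ⟩ := h
  let R := T ⧸ Ideal.span {f}
  let p : R ⊗[T] I →ₗ[R] T ⧸ I := φ.liftBaseChange R
  -- For `a ∈ I`, the element `a f = f a` lies in `f I`, so `1 ↦ 1 ⊗ f` descends to `T/I`; `p`
  -- retracts it.
  let σ₀ : (T ⧸ I) →ₗ[T] R ⊗[T] I :=
    I.liftQ (LinearMap.toSpanSingleton T _ ((1 : R) ⊗ₜ ⟨f, hf⟩)) (fun a ha => by
      change a • ((1 : R) ⊗ₜ[T] (⟨f, hf⟩ : I)) = 0
      rw [← tmul_smul, one_tmul_eq_zero_iff]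
      exact ⟨⟨a, ha⟩, Subtype.ext (mul_comm f a)⟩)
  let σ : (T ⧸ I) →ₗ[R] R ⊗[T] I :=
    LinearMap.extendScalarsOfSurjective Ideal.Quotient.mk_surjective σ₀
  have hσ : ∀ x, p (σ x) = x := fun x => by
    obtain ⟨x, rfl⟩ := Ideal.Quotient.mk_surjective x
    change p (x • ((1 : R) ⊗ₜ[T] (⟨f, hf⟩ : I))) = _
    rw [← tmul_smul, LinearMap.liftBaseChange_tmul, one_smul, map_smul, hφ, Algebra.smul_def,
      mul_one]
    rfl
  have hbij : Function.Bijective (LinearMap.coprod σ (LinearMap.ker p).subtype) := by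
    constructor
    · refine (injective_iff_map_eq_zero _).mpr ?_
      rintro ⟨x, n⟩ hxn
      have hxn' : σ x + n = 0 := hxn
      have hx : x = 0 := by
        have := congrArg p hxn'
        rwa [map_add, hσ, LinearMap.mem_ker.mp n.2, add_zero, map_zero] at this
      subst hx
      rw [map_zero, zero_add] at hxn'
      exact Prod.ext rfl (Subtype.ext hxn')
    · intro y
      refine ⟨(p y, ⟨y - σ (p y), ?_⟩), ?_⟩
      · rw [LinearMap.mem_ker, map_sub, hσ, sub_self]
      · simp
  refine ⟨LinearMap.ker p, inferInstance, inferInstance, inferInstance, ModuleCat.of T I,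
    inferInstanceAs (Module.Finite T I), ?_, ⟨LinearEquiv.ofBijective _ hbij⟩⟩
  refine (isZero_tor_quotient_span_singleton_iff hreg _).mpr fun a b hab => ?_
  have hab' : f * (a : I).1 = f * (b : I).1 := congrArg Subtype.val hab
  exact Subtype.ext ((mul_cancel_left_mem_nonZeroDivisors hreg).mp hab')

lemma isWeaklyLiftableMod_iff [IsNoetherianRing T] {I : Ideal T} {f : T} (hf : f ∈ I)
    (hreg : f ∈ nonZeroDivisors T) (htors : Module.IsTorsionBy T (T ⧸ I) f) :
    IsWeaklyLiftableMod (T ⧸ I) f htors ↔ ∃ φ : I →ₗ[T] T ⧸ I, φ ⟨f, hf⟩ = 1 := by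
  let _ : Module (T ⧸ Ideal.span {f}) (T ⧸ I) := htors.module
  have : IsScalarTower T (T ⧸ Ideal.span {f}) (T ⧸ I) :=
    ⟨fun a b x => by
      obtain ⟨b, rfl⟩ := Ideal.Quotient.mk_surjective b
      change Ideal.Quotient.mk _ (a * b) • x = a • Ideal.Quotient.mk _ b • x
      rw [Module.IsTorsionBy.mk_smul htors, Module.IsTorsionBy.mk_smul htors, mul_smul]⟩
  exact ⟨exists_linearMap_eq_one_of_isWeaklyLiftable hf hreg,
    isWeaklyLiftable_of_linearMap_eq_one hf hreg⟩

lemma isTorsionBy_quotient_iff {I : Ideal T} {f : T} :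
    Module.IsTorsionBy T (T ⧸ I) f ↔ f ∈ I := by
  constructor
  · intro h
    have h1 := @h (1 : T ⧸ I)
    rw [Algebra.smul_def, mul_one] at h1
    exact Ideal.Quotient.eq_zero_iff_mem.mp h1
  · intro h x
    rw [Algebra.smul_def]
    exact (congrArg (· * x) (Ideal.Quotient.eq_zero_iff_mem.mpr h)).trans (zero_mul x)

lemma IsSocleChain.mem_nwlLocus_iff [IsLocalRing T] [IsNoetherianRing T] {I : Ideal T}
    {J : ℕ → Ideal T} {s : ℕ → T} (h : IsSocleChain I J s) {f : T}
    (hreg : f ∈ nonZeroDivisors T) :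
    f ∈ nwlLocus T (T ⧸ I) ↔ f ∈ ⨆ i, socleColon I (J i) (s i) := by
  have hne : f ≠ 0 := nonZeroDivisors.ne_zero hreg
  by_cases hf : f ∈ I
  · have htors := isTorsionBy_quotient_iff.mpr hf
    rw [← not_iff_not, ← h.exists_linearMap_iff hf, ← isWeaklyLiftableMod_iff hf hreg htors]
    simp only [nwlLocus, Set.mem_ofPred_eq, hne, false_or, exists_prop_of_true htors, not_not]
  · refine iff_of_false (fun ⟨htors, _⟩ => hf (isTorsionBy_quotient_iff.mp htors)) fun hmem => hf ?_
    exact iSup_le (fun i => (inf_le_right : socleColon I (J i) (s i) ≤ I)) hmem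

lemma IsSocleChain.nwlLocus_eq [IsLocalRing T] [IsNoetherianRing T] {I : Ideal T}
    {J : ℕ → Ideal T} {s : ℕ → T} (h : IsSocleChain I J s)
    (hI : ∀ f ∈ I, f ≠ 0 → f ∈ nonZeroDivisors T) :
    nwlLocus T (T ⧸ I) = ((⨆ i, socleColon I (J i) (s i) : Ideal T) : Set T) := by
  ext f
  by_cases hf0 : f = 0
  · subst hf0
    exact iff_of_true ⟨isTorsionBy_quotient_iff.mpr I.zero_mem, Or.inl rfl⟩ (zero_mem _)
  by_cases hf : f ∈ I
  · exact h.mem_nwlLocus_iff (hI f hf hf0)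
  · refine iff_of_false (fun ⟨htors, _⟩ => hf (isTorsionBy_quotient_iff.mp htors)) fun hmem => hf ?_
    exact iSup_le (fun i => (inf_le_right : socleColon I (J i) (s i) ≤ I)) hmem

end Liftable

/-! ### The main theorem -/

theorem proposition5p3 {T : Type u} [CommRing T] [IsNoetherianRing T] [IsLocalRing T]
    (I : Ideal T) (hI : IsApproximatelyGorensteinLocal (T ⧸ I)) :
    ((∀ f ∈ I, f ≠ 0 → f ∈ nonZeroDivisors T) →
      ∃ L : Ideal T, (L : Set T) = nwlLocus T (T ⧸ I)) ∧
    (∃ (J : ℕ → Ideal T) (s : ℕ → T), IsSocleChain I J s) ∧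
    ∀ (J : ℕ → Ideal T) (s : ℕ → T), IsSocleChain I J s →
      Monotone (fun i => socleColon I (J i) (s i)) ∧
      (∃ n, ∀ k, n ≤ k →
        socleColon I (J k) (s k) = ⨆ i, socleColon I (J i) (s i)) ∧
      (∀ f ∈ nonZeroDivisors T,
        (f ∈ nwlLocus T (T ⧸ I) ↔ f ∈ ⨆ i, socleColon I (J i) (s i))) ∧
      ((∀ f ∈ I, f ≠ 0 → f ∈ nonZeroDivisors T) →
        nwlLocus T (T ⧸ I) = ((⨆ i, socleColon I (J i) (s i) : Ideal T) : Set T)) := by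
  refine ⟨fun hreg => ?_, hI.exists_isSocleChain, fun J s h => ⟨h.monotone_socleColon, ?_,
    fun f hf => h.mem_nwlLocus_iff hf, h.nwlLocus_eq⟩⟩
  · obtain ⟨J, s, h⟩ := hI.exists_isSocleChain
    exact ⟨_, (h.nwlLocus_eq hreg).symm⟩
  · obtain ⟨n, hn⟩ := monotone_stabilizes_iff_noetherian.mpr (inferInstance : IsNoetherian T T)
      ⟨_, h.monotone_socleColon⟩
    refine ⟨n, fun k hk => le_antisymm (le_iSup (fun i => socleColon I (J i) (s i)) k)
      (iSup_le fun i => ?_)⟩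
    rcases le_total i k with hik | hki
    · exact h.monotone_socleColon hik
    · exact ((hn i (hk.trans hki)).symm.trans (hn k hk)).le
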